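/- **Theorem (Poisson Mixture Process).** Let $\Omega$ be a measurable space, $G_0$ a finite measure on $\Omega$, and $\rho$ a measure on $(0,\infty)$ with $\int_0^\infty \min\{1,r\}\,\rho(dr)<\infty$. A random measure $G$ on $\Omega$ with $G(\Omega)<\infty$ almost surely is called a completely random measure with Lévy measure $\nu$, where $\nu$ is a measure on $(0,\infty)\times\Omega$ with $\iint\min\{1,r\}\,\nu(dr\,d\omega)<\infty$, if for pairwise disjoint measurable sets $A_1,\dots,A_N\subset\Omega$ the variables $G(A_1),\dots,G(A_N)$ are independent, and $\mathbb{E}[e^{iuG(A)}]=\exp\big\{\iint_{(0,\infty)\times A}(e^{iur}-1)\,\nu(dr\,d\omega)\big\}$ for every measurable $A\subset\Omega$ and $u\in\mathbb{R}$. Let $G=\sum_{k=1}^{K} r_k\delta_{\omega_k}$ (with a random number $K\le\infty$ of atoms, random weights $r_k\ge 0$ and random locations $\omega_k\in\Omega$) be a completely random measure with Lévy measure $\nu(dr\,d\omega)=\rho(dr)\,G_0(d\omega)$. Conditionally on $(K,(r_k)_k,(\omega_k)_k)$, let the counts $n_k$, $k\le K$, be independent with $n_k\sim\mathrm{Pois}(r_k)$,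 and let $X:=\sum_{k=1}^{K} n_k\delta_{\omega_k}$. Then: 1. $X$ is a $G$-mixed Poisson process: conditionally on $G$, for pairwise disjoint measurable sets $A_1,\dots,A_N$ the variables $X(A_1),\dots,X(A_N)$ are independent with $X(A_i)\sim\mathrm{Pois}(G(A_i))$. 2. With $G$ marginalized out, for every measurable $A\subset\Omega$ and $u\in\mathbb{R}$, $$\mathbb{E}\big[e^{iuX(A)}\big]=\exp\Big\{G_0(A)\sum_{n=1}^\infty (e^{iun}-1)\int_0^\infty \frac{r^n e^{-r}}{n!}\,\rho(dr)\Big\},$$ where all the integrals are finite and the series converges absolutely. 3. With $G$ marginalized out, $X$ is a completely random measure with Lévy measure $$\tilde\nu(dn\,d\omega)=\sum_{j=1}^\infty \int_0^\infty \frac{r^j e^{-r}}{j!}\,\rho(dr)\;\delta_j(dn)\,G_0(d\omega).$$ -/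

import Mathlib

open MeasureTheory ProbabilityTheory Set
open scoped ENNReal NNReal

noncomputable section

namespace CountMixture

/-- `ν` on `ℝ × Ω` is a Lévy measure (for a nonnegative random measure without drift): it is
carried by positive jump sizes, and `∫∫ min{1, r} ν(dr dω) < ∞`. -/
structure IsLevyMeasure {Ω : Type*} [MeasurableSpace Ω] (ν : Measure (ℝ × Ω)) : Prop where
  null_nonpos : ν (Iic 0 ×ˢ univ) = 0
  lintegral_min_lt_top : ∫⁻ p, ENNReal.ofReal (min 1 p.1) ∂ν < ∞

/-- The random measure `G` on `Ω` is a completely random measure with finite total mass and with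
Lévy measure `ν`: it gives independent values to disjoint sets, and
`E[exp(iuG(A))] = exp(∫∫_{ℝ₊ × A} (exp(iur) - 1) ν(dr dω))`. -/
structure IsCompletelyRandomMeasure {S Ω : Type*} [MeasurableSpace S] [MeasurableSpace Ω]
    (P : Measure S) (G : S → Measure Ω) (ν : Measure (ℝ × Ω)) : Prop where
  measurable : Measurable G
  ae_finite : ∀ᵐ s ∂P, G s univ < ∞
  isLevyMeasure : IsLevyMeasure ν
  indep : ∀ (N : ℕ) (A : Fin N → Set Ω), (∀ i, MeasurableSet (A i)) →
    Pairwise (fun i j => Disjoint (A i) (A j)) → iIndepFun (fun i s => G s (A i)) P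
  charFun_eq : ∀ A : Set Ω, MeasurableSet A → ∀ u : ℝ,
    ∫ s, Complex.exp (Complex.I * u * (G s A).toReal) ∂P =
      Complex.exp (∫ p in univ ×ˢ A, (Complex.exp (Complex.I * u * p.1) - 1) ∂ν)

/-- `X` is a mixed Poisson process directed by the random measure `G`: conditionally on `G`, it is
a Poisson process with mean measure `G`, that is, the values of `X` on disjoint sets `A i` are
independent and Poisson distributed with means `G (A i)`. -/
structure IsMixedPoissonProcess {S Ω : Type*} [MeasurableSpace S] [MeasurableSpace Ω]
    (P : Measure S) (G X : S → Measure Ω) : Prop where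
  measurable_directing : Measurable G
  measurable : Measurable X
  ae_finite_directing : ∀ᵐ s ∂P, G s univ < ∞
  cond_poisson : ∀ (N : ℕ) (A : Fin N → Set Ω), (∀ i, MeasurableSet (A i)) →
    Pairwise (fun i j => Disjoint (A i) (A j)) → ∀ j : Fin N → ℕ,
      P⟦{s | ∀ i, X s (A i) = (j i : ℝ≥0∞)} | MeasurableSpace.comap G inferInstance⟧ =ᵐ[P]
        fun s => ∏ i, (poissonMeasure (G s (A i)).toNNReal).real {j i}

/-- The random measure `∑_{k < K} w_k δ_{ω_k}`, with `K ≤ ∞` atoms (numbered from `0`). -/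
def atomicMeasure {S Ω : Type*} [MeasurableSpace Ω]
    (K : S → ℕ∞) (w : ℕ → S → ℝ≥0) (ω : ℕ → S → Ω) (s : S) : Measure Ω :=
  Measure.sum fun k : ℕ =>
    (if (k : ℕ∞) < K s then (w k s : ℝ≥0∞) else 0) • Measure.dirac (ω k s)

/-- The σ-algebra generated by the number `K`, the weights `r_k` and the locations `ω_k` of the
atoms. -/
abbrev atomSigma {S Ω : Type*} [MeasurableSpace Ω]
    (K : S → ℕ∞) (r : ℕ → S → ℝ≥0) (ω : ℕ → S → Ω) : MeasurableSpace S :=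
  MeasurableSpace.comap (fun s => (K s, (fun k => r k s), (fun k => ω k s))) inferInstance

/-- The count-mixture model: `G = ∑_{k < K} r_k δ_{ω_k}` is a homogeneous completely random
measure with Lévy measure `ρ(dr) G₀(dω)`, and, given the atoms of `G`, the counts `n_k`, `k < K`,
are independent with `n_k ∼ Pois(r_k)`. Indices `k ≥ K` carry weight `0` and count `0`. -/
structure IsCountMixture {S Ω : Type*} [MeasurableSpace S] [MeasurableSpace Ω]
    (P : Measure S) (ρ : Measure ℝ) (G₀ : Measure Ω)
    (K : S → ℕ∞) (r : ℕ → S → ℝ≥0) (ω : ℕ → S → Ω) (n : ℕ → S → ℕ) : Prop where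
  measurable_K : Measurable K
  measurable_r : ∀ k, Measurable (r k)
  measurable_ω : ∀ k, Measurable (ω k)
  measurable_n : ∀ k, Measurable (n k)
  crm : IsCompletelyRandomMeasure P (atomicMeasure K r ω) (ρ.prod G₀)
  cond_counts : ∀ (N : ℕ) (j : Fin N → ℕ),
    P⟦{s | ∀ i : Fin N, (if ((i : ℕ) : ℕ∞) < K s then n i s else 0) = j i} | atomSigma K r ω⟧
      =ᵐ[P] fun s =>
        ∏ i : Fin N, (poissonMeasure (if ((i : ℕ) : ℕ∞) < K s then r i s else 0)).real {j i}

/-- The measure `∑_{j ≥ 1} (∫ r^j e^{-r} / j! ρ(dr)) δ_j(dn) G₀(dω)` on `ℝ × Ω`. -/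
def mixtureLevyMeasure {Ω : Type*} [MeasurableSpace Ω] (ρ : Measure ℝ) (G₀ : Measure Ω) :
    Measure (ℝ × Ω) :=
  Measure.sum fun m : ℕ =>
    (∫⁻ r in Ioi 0, ENNReal.ofReal (r ^ (m + 1) * Real.exp (-r) / (m + 1).factorial) ∂ρ) •
      (Measure.dirac ((m + 1 : ℕ) : ℝ)).prod G₀

end CountMixture

end

/-! Condition on the atoms. Once `K`, the weights and the locations are frozen, `X (A i)` is a sum
of independent Poisson counts over the indices whose location lies in `A i`. Disjoint sets use
disjoint index blocks, so these sums are independent and Poisson with means `G (A i)`. The resulting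
probabilities depend on the atoms only through `G`, so they are also the conditional probabilities
given `G`. Everything is done in the integrated form P(B ∩ E) = ∫_B g dP
(`IsCountMixture.measure_inter_eq`).

Averaging over `G` gives E exp(iuX(A)) = E exp(-zG(A)) with z = 1 - exp(iu)
(`IsCountMixture.integral_exp_eq`). The model supplies this transform only for imaginary z. Both E
exp(-zG(A)) and exp(G₀(A) ∫ (exp(-zr) - 1) ρ(dr)) are bounded, analytic in the right half plane and
continuous up to its boundary, so by Phragmén–Lindelöf they agree there
(`integral_exp_neg_mul_eq_of_charFun`). At z = 1 - exp(iu) the integrand expands as the required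
series in n. The identity ∑_{n≥1} rⁿe⁻ʳ/n! = 1 - e⁻ʳ ≤ min(1, r) controls every interchange.

Independence of the `X (A i)` follows because their joint mass function is the expectation of a
product of functions of the independent variables `G (A i)`. -/

namespace CountMixture

/-! ### Block sums of independent Poisson variables. -/

section Poisson

lemma poissonMeasure_zero : poissonMeasure 0 = Measure.dirac 0 := by
  refine Measure.ext_of_singleton fun a => ?_
  rw [poissonMeasure_singleton]
  rcases Nat.eq_zero_or_pos a with rfl | ha
  · simp
  · rw [Measure.dirac_apply' _ (measurableSet_singleton a)]
    simp [ha.ne', ha.ne]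

lemma continuous_poissonMeasure_real_singleton (j : ℕ) :
    Continuous fun c : ℝ≥0 => (poissonMeasure c).real {j} := by
  simp only [poissonMeasure_real_singleton]
  fun_prop

/-- A finite sum of independent Poisson variables is Poisson. -/
lemma hasLaw_sum_poissonMeasure {Ξ ι : Type*} [MeasurableSpace Ξ] {μ : Measure Ξ}
    [IsProbabilityMeasure μ] {f : ι → Ξ → ℕ} {c : ι → ℝ≥0} (hf : ∀ k, Measurable (f k))
    (hind : iIndepFun f μ) (hlaw : ∀ k, HasLaw (f k) (poissonMeasure (c k)) μ) (s : Finset ι) :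
    HasLaw (∑ k ∈ s, f k) (poissonMeasure (∑ k ∈ s, c k)) μ := by
  classical
  induction s using Finset.induction_on with
  | empty =>
    refine ⟨by fun_prop, ?_⟩
    rw [Finset.sum_empty, Finset.sum_empty, poissonMeasure_zero]
    change μ.map (fun _ => 0) = _
    rw [Measure.map_const]
    simp
  | insert a s ha ih =>
    rw [Finset.sum_insert ha, Finset.sum_insert ha, add_comm (f a), add_comm (c a)]
    exact (hind.indepFun_finsetSum_of_notMem hf ha).hasLaw_add_poissonMeasure ih (hlaw a)

/-- The sums of independent Poisson variables over disjoint blocks are independent Poisson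
variables. -/
lemma measure_block_sums_eq {Ξ ι κ : Type*} [MeasurableSpace Ξ] [DecidableEq κ] {μ : Measure Ξ}
    [IsProbabilityMeasure μ] {f : ι → Ξ → ℕ} {c : ι → ℝ≥0} (hf : ∀ k, Measurable (f k))
    (hind : iIndepFun f μ) (hlaw : ∀ k, HasLaw (f k) (poissonMeasure (c k)) μ)
    (C : κ → Finset ι) (hC : Pairwise fun i j => Disjoint (C i) (C j)) (m : κ → ℕ)
    (t : Finset κ) :
    μ {x | ∀ i ∈ t, ∑ k ∈ C i, f k x = m i} =
      ∏ i ∈ t, poissonMeasure (∑ k ∈ C i, c k) {m i} := by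
  classical
  induction t using Finset.induction_on with
  | empty => simp
  | insert a t ha ih =>
    have hdisj : Disjoint (C a) (t.biUnion C) := by
      rw [Finset.disjoint_biUnion_right]
      intro i hi
      exact hC (fun h => ha (h ▸ hi))
    have hI := hind.indepFun_finset _ _ hdisj hf
    set U : Set (C a → ℕ) := {v | ∑ k : C a, v k = m a} with hU
    set V : Set (t.biUnion C → ℕ) := {v | ∀ i, ∀ hi : i ∈ t,
      ∑ k : C i, v ⟨k, Finset.mem_biUnion.2 ⟨i, hi, k.2⟩⟩ = m i} with hV
    have h1 : (fun x (k : C a) => f k x) ⁻¹' U = {x | ∑ k ∈ C a, f k x = m a} := by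
      ext x
      simp only [hU, mem_preimage, mem_ofPred_eq]
      rw [Finset.sum_coe_sort (C a) (fun k => f k x)]
    have h2 : (fun x (k : t.biUnion C) => f k x) ⁻¹' V =
        {x | ∀ i ∈ t, ∑ k ∈ C i, f k x = m i} := by
      ext x
      simp only [hV, mem_preimage, mem_ofPred_eq]
      refine forall₂_congr fun i hi => ?_
      rw [Finset.sum_coe_sort (C i) (fun k => f k x)]
    have hmul := hI.measure_inter_preimage_eq_mul U V (Set.to_countable _).measurableSet
      (Set.to_countable _).measurableSet
    rw [h1, h2, ih] at hmul
    have h3 : {x | ∀ i ∈ insert a t, ∑ k ∈ C i, f k x = m i} =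
        {x | ∑ k ∈ C a, f k x = m a} ∩ {x | ∀ i ∈ t, ∑ k ∈ C i, f k x = m i} := by
      ext x; simp
    rw [h3, hmul, Finset.prod_insert ha]
    congr 1
    have hl := hasLaw_sum_poissonMeasure hf hind hlaw (C a)
    rw [← hl.map_eq, Measure.map_apply_of_aemeasurable hl.aemeasurable (measurableSet_singleton _)]
    congr 1
    ext x; simp

/-- The mass that a finite product of Poisson laws gives to prescribed block sums. -/
lemma tsum_indicator_prod_poissonMeasure {ι κ : Type*} [Fintype ι] [Fintype κ] (c : ι → ℝ≥0)
    (C : κ → Finset ι) (hC : Pairwise fun i j => Disjoint (C i) (C j)) (m : κ → ℕ) :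
    ∑' j : ι → ℕ, {j : ι → ℕ | ∀ i, ∑ k ∈ C i, j k = m i}.indicator
        (fun j => ∏ k, poissonMeasure (c k) {j k}) j =
      ∏ i, poissonMeasure (∑ k ∈ C i, c k) {m i} := by
  classical
  -- Realise the counts as coordinates on a product space: the left-hand side is then the `μ`-mass
  -- of the block-sum event, summed over singletons.
  set μ := Measure.pi fun k => poissonMeasure (c k) with hμ
  have hind : iIndepFun (fun (k : ι) (j : ι → ℕ) => j k) μ :=
    iIndepFun_pi (X := fun _ => id) fun _ => aemeasurable_id
  have hlaw (k : ι) : HasLaw (fun j : ι → ℕ => j k) (poissonMeasure (c k)) μ :=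
    (measurePreserving_eval (fun k => poissonMeasure (c k)) k).hasLaw
  have h := measure_block_sums_eq (fun k => measurable_pi_apply k) hind hlaw C hC m Finset.univ
  simp only [Finset.mem_univ, true_implies] at h
  rw [← h]
  have := Measure.tsum_indicator_apply_singleton μ {j : ι → ℕ | ∀ i, ∑ k ∈ C i, j k = m i}
    (Set.to_countable _).measurableSet
  rw [← this]
  refine tsum_congr fun j => ?_
  simp only [Set.indicator, hμ, Measure.pi_singleton]

end Poisson

/-! ### Conditionally independent Poisson counts in random blocks. -/

section Conditional

open Filter Topology

/-- Convergent integer sequences are eventually constant; if the series, possibly infinite, misses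
`m`, its partial sums eventually do too. This makes the indicators of the truncated events converge
pointwise. -/
lemma eventually_sum_range_eq_iff (a : ℕ → ℕ) (m : ℕ) :
    ∀ᶠ N in atTop, (∑ k ∈ Finset.range N, a k = m ↔ ∑' k, (a k : ℝ≥0∞) = m) := by
  have ht : Tendsto (fun N => ((∑ k ∈ Finset.range N, a k : ℕ) : ℝ≥0∞)) atTop
      (𝓝 (∑' k, (a k : ℝ≥0∞))) := by
    simpa using ENNReal.tendsto_nat_tsum fun k => (a k : ℝ≥0∞)
  by_cases h : ∑' k, (a k : ℝ≥0∞) = m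
  · rw [h] at ht
    have h1 : Tendsto (fun N => ∑ k ∈ Finset.range N, a k) atTop (𝓝 m) := by
      rw [Nat.isClosedEmbedding_coe_real.isEmbedding.tendsto_nhds_iff]
      have := (ENNReal.tendsto_toReal (ENNReal.natCast_ne_top m)).comp ht
      simpa only [Function.comp_def, ENNReal.toReal_natCast] using this
    rw [nhds_discrete, tendsto_pure] at h1
    filter_upwards [h1] with N hN
    simp [hN, h]
  · filter_upwards [ht.eventually_ne h] with N hN
    simp only [h, iff_false]
    exact fun h' => hN (by rw [h'])

lemma measurableSet_forall_sum_indicator {S ι κ : Type*} {mS : MeasurableSpace S} [Fintype ι]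
    [Countable κ] {D : ι → κ → Set S} (hD : ∀ k i, MeasurableSet (D k i)) (j : ι → ℕ) (m : κ → ℕ) :
    MeasurableSet {s | ∀ i, ∑ k, (D k i).indicator (fun _ => j k) s = m i} := by
  rw [ofPred_forall]
  refine MeasurableSet.iInter fun i => ?_
  have : Measurable fun s => ∑ k, (D k i).indicator (fun _ => j k) s :=
    Finset.measurable_sum _ fun k _ => measurable_const.indicator (hD k i)
  exact this (measurableSet_singleton _)

variable {S κ : Type*} {m₀ mS : MeasurableSpace S} [Fintype κ] {P : Measure S}

/-- The integrated form of a conditional probability with values in `[0, 1]`. -/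
lemma measure_inter_eq_of_condExp [IsFiniteMeasure P] (hm : m₀ ≤ mS) {E : Set S}
    (hE : MeasurableSet E) {g : S → ℝ}
    (hg0 : ∀ s, 0 ≤ g s) (hg : P⟦E | m₀⟧ =ᵐ[P] g) {B : Set S} (hB : MeasurableSet[m₀] B) :
    P (B ∩ E) = ∫⁻ s in B, ENNReal.ofReal (g s) ∂P := by
  have hint : Integrable g P := integrable_condExp.congr hg
  rw [← ofReal_integral_eq_lintegral_ofReal hint.integrableOn (Eventually.of_forall hg0),
    ← integral_congr_ae (ae_restrict_of_ae hg),
    setIntegral_condExp hm ((integrable_const 1).indicator hE) hB, integral_indicator hE]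
  simp [measureReal_def, Measure.restrict_apply hE, inter_comm]

/-- The converse of `measure_inter_eq_of_condExp`. -/
lemma condExp_eq_of_measure_inter [IsFiniteMeasure P] (hm : m₀ ≤ mS) {E : Set S}
    (hE : MeasurableSet E) {g : S → ℝ}
    (hg0 : ∀ s, 0 ≤ g s) (hg1 : ∀ s, g s ≤ 1) (hgm : Measurable[m₀] g)
    (h : ∀ B, MeasurableSet[m₀] B → P (B ∩ E) = ∫⁻ s in B, ENNReal.ofReal (g s) ∂P) :
    P⟦E | m₀⟧ =ᵐ[P] g := by
  have hint : Integrable g P := by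
    refine Integrable.of_bound (hgm.mono hm le_rfl).aestronglyMeasurable 1
      (Eventually.of_forall fun s => ?_)
    rw [Real.norm_of_nonneg (hg0 s)]
    exact hg1 s
  symm
  refine ae_eq_condExp_of_forall_setIntegral_eq hm ((integrable_const 1).indicator hE)
    (fun _ _ _ => hint.integrableOn) (fun B hB _ => ?_) hgm.stronglyMeasurable.aestronglyMeasurable
  rw [integral_indicator hE, integral_eq_lintegral_of_nonneg_ae (Eventually.of_forall hg0)
    hint.integrableOn.aestronglyMeasurable, ← h B hB]
  simp [measureReal_def, Measure.restrict_apply hE, inter_comm]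

variable {c : ℕ → S → ℝ≥0} {y : ℕ → S → ℕ} {D : ℕ → κ → Set S}

/-- Conditionally independent Poisson counts, summed over finitely many indices in disjoint random
blocks, are conditionally independent Poisson variables. -/
lemma measure_inter_block_sums_range_eq (hm : m₀ ≤ mS) (hc : ∀ k, Measurable[m₀] (c k))
    (hy : ∀ k, Measurable (y k)) (hD : ∀ k i, MeasurableSet[m₀] (D k i))
    (hdisj : ∀ k, Pairwise fun i j => Disjoint (D k i) (D k j))
    (hcond : ∀ (N : ℕ) (j : Fin N → ℕ) (B : Set S), MeasurableSet[m₀] B →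
      P (B ∩ {s | ∀ i : Fin N, y i s = j i}) =
        ∫⁻ s in B, ∏ i : Fin N, poissonMeasure (c i s) {j i} ∂P)
    (N : ℕ) (m : κ → ℕ) {B : Set S} (hB : MeasurableSet[m₀] B) :
    P (B ∩ {s | ∀ i, ∑ k ∈ Finset.range N, (D k i).indicator (y k) s = m i}) =
      ∫⁻ s in B, ∏ i,
        poissonMeasure (∑ k ∈ Finset.range N, (D k i).indicator (c k) s) {m i} ∂P := by
  classical
  -- `W j` says that the deterministic count vector `j` has the prescribed sums over the random
  -- blocks. It is `m₀`-measurable, so it can be absorbed into the conditioning set.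
  set W : (Fin N → ℕ) → Set S := fun j =>
    {s | ∀ i, ∑ k : Fin N, (D k i).indicator (fun _ => j k) s = m i} with hW
  have hWm (j) : MeasurableSet[m₀] (W j) := by
    exact measurableSet_forall_sum_indicator (fun (k : Fin N) i => hD k i) _ _
  have hEm (j : Fin N → ℕ) : MeasurableSet {s | ∀ i : Fin N, y i s = j i} := by
    rw [ofPred_forall]
    exact MeasurableSet.iInter fun i => hy i (measurableSet_singleton (j i))
  have hsplit : B ∩ {s | ∀ i, ∑ k ∈ Finset.range N, (D k i).indicator (y k) s = m i} =
      ⋃ j : Fin N → ℕ, (B ∩ W j) ∩ {s | ∀ i : Fin N, y i s = j i} := by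
    ext s
    simp only [hW, mem_inter_iff, mem_ofPred_eq, mem_iUnion, Finset.sum_range]
    constructor
    · rintro ⟨hs, h⟩
      exact ⟨fun k => y k s, ⟨hs, h⟩, fun _ => rfl⟩
    · rintro ⟨j, ⟨hs, h⟩, hj⟩
      refine ⟨hs, fun i => ?_⟩
      rw [← h i]
      refine Finset.sum_congr rfl fun k _ => ?_
      simp only [indicator, hj k]
  rw [hsplit, measure_iUnion]
  · simp_rw [hcond N _ _ (hB.inter (hWm _)), inter_comm B, ← Measure.restrict_restrict
      (hm _ (hWm _)), ← lintegral_indicator (hm _ (hWm _))]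
    rw [← lintegral_tsum]
    -- For fixed `s` the blocks are deterministic, and the sum over `j` is the block-sum mass of a
    -- product of Poisson laws.
    · refine lintegral_congr fun s => ?_
      have := tsum_indicator_prod_poissonMeasure (fun k : Fin N => c k s)
        (fun i => Finset.univ.filter fun k : Fin N => s ∈ D k i) ?_ m
      · simp only [Finset.sum_range]
        simp only [Finset.sum_filter] at this
        exact this
      · intro i i' hii
        rw [Finset.disjoint_filter]
        exact fun k _ h h' => disjoint_left.1 (hdisj k hii) h h'
    · intro j
      refine (Measurable.indicator ?_ (hm _ (hWm _))).aemeasurable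
      refine Finset.measurable_prod _ fun k _ => ?_
      simp only [poissonMeasure_singleton]
      have := (hc k).mono hm le_rfl
      fun_prop
  · intro j j' hjj
    refine disjoint_left.2 fun s hs hs' => hjj ?_
    ext i
    rw [← hs.2 i, hs'.2 i]
  · exact fun j => ((hm _ hB).inter (hm _ (hWm j))).inter (hEm j)

/-- Conditionally independent Poisson counts, summed in disjoint random blocks, are conditionally
independent Poisson variables. -/
lemma measure_inter_block_tsum_eq [IsFiniteMeasure P] (hm : m₀ ≤ mS)
    (hc : ∀ k, Measurable[m₀] (c k))
    (hy : ∀ k, Measurable (y k)) (hD : ∀ k i, MeasurableSet[m₀] (D k i))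
    (hdisj : ∀ k, Pairwise fun i j => Disjoint (D k i) (D k j))
    (hcond : ∀ (N : ℕ) (j : Fin N → ℕ) (B : Set S), MeasurableSet[m₀] B →
      P (B ∩ {s | ∀ i : Fin N, y i s = j i}) =
        ∫⁻ s in B, ∏ i : Fin N, poissonMeasure (c i s) {j i} ∂P)
    (hfin : ∀ᵐ s ∂P, ∀ i, ∑' k, (((D k i).indicator (c k) s : ℝ≥0) : ℝ≥0∞) ≠ ∞)
    (m : κ → ℕ) {B : Set S} (hB : MeasurableSet[m₀] B) :
    P (B ∩ {s | ∀ i, ∑' k, (((D k i).indicator (y k) s : ℕ) : ℝ≥0∞) = m i}) =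
      ∫⁻ s in B, ∏ i,
        poissonMeasure (∑' k, (((D k i).indicator (c k) s : ℝ≥0) : ℝ≥0∞)).toNNReal {m i} ∂P := by
  have hyD (k i) : Measurable ((D k i).indicator (y k)) := (hy k).indicator (hm _ (hD k i))
  have hcD (k i) : Measurable ((D k i).indicator (c k)) :=
    ((hc k).mono hm le_rfl).indicator (hm _ (hD k i))
  have hl : Tendsto
      (fun N => P (B ∩ {s | ∀ i, ∑ k ∈ Finset.range N, (D k i).indicator (y k) s = m i})) atTop
      (𝓝 (P (B ∩ {s | ∀ i, ∑' k, (((D k i).indicator (y k) s : ℕ) : ℝ≥0∞) = m i}))) := by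
    refine tendsto_measure_of_ae_tendsto_indicator_of_isFiniteMeasure atTop
      ((hm _ hB).inter ?_) (fun N => (hm _ hB).inter ?_) (Eventually.of_forall fun s => ?_)
    · rw [ofPred_forall]
      refine MeasurableSet.iInter fun i => ?_
      have : Measurable fun s => ∑' k, (((D k i).indicator (y k) s : ℕ) : ℝ≥0∞) := by fun_prop
      exact this (measurableSet_singleton _)
    · rw [ofPred_forall]
      refine MeasurableSet.iInter fun i => ?_
      have : Measurable fun s => ∑ k ∈ Finset.range N, (D k i).indicator (y k) s := by fun_prop
      exact this (measurableSet_singleton _)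
    · have : ∀ᶠ N in atTop, ∀ i, (∑ k ∈ Finset.range N, (D k i).indicator (y k) s = m i ↔
          ∑' k, (((D k i).indicator (y k) s : ℕ) : ℝ≥0∞) = m i) :=
        eventually_all.2 fun i => eventually_sum_range_eq_iff (fun k => (D k i).indicator (y k) s) _
      filter_upwards [this] with N hN
      simp only [mem_inter_iff, mem_ofPred_eq, hN]
  have hr : Tendsto (fun N => ∫⁻ s in B, ∏ i,
        poissonMeasure (∑ k ∈ Finset.range N, (D k i).indicator (c k) s) {m i} ∂P) atTop
      (𝓝 (∫⁻ s in B, ∏ i,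
        poissonMeasure (∑' k, (((D k i).indicator (c k) s : ℝ≥0) : ℝ≥0∞)).toNNReal {m i} ∂P)) := by
    refine tendsto_lintegral_of_dominated_convergence (fun _ => 1) (fun N => ?_) (fun N => ?_) ?_ ?_
    · refine Finset.measurable_prod _ fun k _ => ?_
      simp only [poissonMeasure_singleton]
      fun_prop
    · exact Eventually.of_forall fun s => Finset.prod_le_one' fun i _ => prob_le_one
    · simp
    -- Finiteness of the means is essential: `toNNReal` would send an infinite mean to `0`, breaking
    -- continuity in the limit.
    · refine ae_restrict_of_ae (hfin.mono fun s hs => ?_)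
      refine ENNReal.tendsto_finsetProd_of_ne_top _ (fun i _ => ?_)
        fun i _ => measure_ne_top _ _
      have h1 : Tendsto (fun N => ∑ k ∈ Finset.range N, (D k i).indicator (c k) s) atTop
          (𝓝 (∑' k, (((D k i).indicator (c k) s : ℝ≥0) : ℝ≥0∞)).toNNReal) := by
        have := (ENNReal.tendsto_toNNReal (hs i)).comp
          (ENNReal.tendsto_nat_tsum fun k => (((D k i).indicator (c k) s : ℝ≥0) : ℝ≥0∞))
        refine this.congr fun N => ?_
        simp only [Function.comp_apply]
        rw [← ENNReal.ofNNReal_finsetSum, ENNReal.toNNReal_coe]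
      have h2 := (ENNReal.continuous_ofReal.comp
        (continuous_poissonMeasure_real_singleton (m i))).continuousAt.tendsto.comp h1
      simp only [poissonMeasure_singleton]
      simpa only [Function.comp_def, poissonMeasure_real_singleton] using h2
  refine tendsto_nhds_unique hl (hr.congr fun N => ?_)
  exact (measure_inter_block_sums_range_eq hm hc hy hD hdisj hcond N m hB).symm

end Conditional

/-! ### From characteristic function to Laplace transform. -/

section Laplace

open Filter Topology

lemma norm_exp_neg_le_one {w : ℂ} (hw : 0 ≤ w.re) : ‖Complex.exp (-w)‖ ≤ 1 := by
  rw [Complex.norm_exp]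
  simpa using hw

lemma norm_exp_neg_sub_one_le {w : ℂ} (hw : 0 ≤ w.re) : ‖Complex.exp (-w) - 1‖ ≤ ‖w‖ := by
  have h := (convex_halfSpace_re_ge 0).norm_image_sub_le_of_norm_hasDerivWithin_le
    (f := fun w => Complex.exp (-w)) (f' := fun w => Complex.exp (-w) * -1) (C := 1)
    (fun x _ => ((hasDerivAt_id x).neg.cexp).hasDerivWithinAt)
    (fun x hx => by simpa using norm_exp_neg_le_one hx) (x := 0) (y := w) (by simp) hw
  simpa using h

/-- Large `x` contributes the constant 2 and small `x` the factor `‖z‖`, so the Lévy condition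
dominates the integrand. -/
lemma norm_exp_neg_mul_sub_one_le {z : ℂ} (hz : 0 ≤ z.re) {x : ℝ} (hx : 0 ≤ x) :
    ‖Complex.exp (-(z * x)) - 1‖ ≤ (2 + ‖z‖) * min 1 x := by
  have hw : 0 ≤ (z * x).re := by simpa using mul_nonneg hz hx
  rcases le_total 1 x with h | h
  · rw [min_eq_left h]
    calc ‖Complex.exp (-(z * x)) - 1‖ ≤ ‖Complex.exp (-(z * x))‖ + ‖(1 : ℂ)‖ := norm_sub_le _ _
      _ ≤ 1 + 1 := by gcongr; exacts [norm_exp_neg_le_one hw, by simp]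
      _ ≤ (2 + ‖z‖) * 1 := by linarith [norm_nonneg z]
  · rw [min_eq_right h]
    calc ‖Complex.exp (-(z * x)) - 1‖ ≤ ‖z * x‖ := norm_exp_neg_sub_one_le hw
      _ = ‖z‖ * x := by rw [norm_mul, Complex.norm_real, Real.norm_of_nonneg hx]
      _ ≤ (2 + ‖z‖) * x := by gcongr; linarith

/-- Dominates the `z`-derivative of the integrand: te⁻ᵗ ≤ 1 handles `x ≥ 1`, at the price of a
positive real part `a`. -/
lemma mul_exp_neg_le {a x : ℝ} (ha : 0 < a) (hx : 0 ≤ x) :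
    x * Real.exp (-(a * x)) ≤ (1 + 1 / a) * min 1 x := by
  rcases le_total 1 x with h | h
  · rw [min_eq_left h, mul_one]
    have h1 : a * x * Real.exp (-(a * x)) ≤ 1 := by
      rw [Real.exp_neg, ← div_eq_mul_inv, div_le_one (Real.exp_pos _)]
      linarith [Real.add_one_le_exp (a * x)]
    have h2 : x * Real.exp (-(a * x)) ≤ 1 / a := by
      rw [le_div_iff₀ ha]; linarith
    linarith
  · rw [min_eq_right h]
    have h1 : Real.exp (-(a * x)) ≤ 1 := Real.exp_le_one_iff.2 (by nlinarith)
    have : 0 ≤ 1 / a := by positivity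
    nlinarith

variable {α : Type*} [MeasurableSpace α] {μ : Measure α} {Y : α → ℝ}

lemma integrable_exp_neg_mul_sub_one (hY : AEMeasurable Y μ) (h0 : ∀ᵐ a ∂μ, 0 ≤ Y a)
    (hint : Integrable (fun a => min 1 (Y a)) μ) {z : ℂ} (hz : 0 ≤ z.re) :
    Integrable (fun a => Complex.exp (-(z * Y a)) - 1) μ := by
  refine (hint.const_mul (2 + ‖z‖)).mono' ?_ ?_
  · have : AEMeasurable (fun a => Complex.exp (-(z * Y a)) - 1) μ := by fun_prop
    exact this.aestronglyMeasurable
  · filter_upwards [h0] with a ha using norm_exp_neg_mul_sub_one_le hz ha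

/-- The Laplace exponent is analytic in the right half plane and continuous up to its boundary. -/
lemma diffContOnCl_integral_exp_neg_mul_sub_one (hY : AEMeasurable Y μ) (h0 : ∀ᵐ a ∂μ, 0 ≤ Y a)
    (hint : Integrable (fun a => min 1 (Y a)) μ) :
    DiffContOnCl ℂ (fun z : ℂ => ∫ a, (Complex.exp (-(z * Y a)) - 1) ∂μ) {z | 0 < z.re} := by
  constructor
  · intro z₀ hz₀
    have hz₀' : 0 < z₀.re := hz₀
    -- Half the distance to the imaginary axis keeps the real part away from 0, making the
    -- derivative bound uniform.
    have hball : ∀ z ∈ Metric.ball z₀ (z₀.re / 2), z₀.re / 2 ≤ z.re := by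
      intro z hz
      have h1 := (Complex.abs_re_le_norm (z - z₀)).trans (mem_ball_iff_norm.1 hz).le
      have h2 := (abs_le.1 h1).1
      simp only [Complex.sub_re] at h2
      linarith
    refine DifferentiableAt.differentiableWithinAt (HasDerivAt.differentiableAt
      (hasDerivAt_integral_of_dominated_loc_of_deriv_le (Metric.ball_mem_nhds z₀ (half_pos hz₀'))
      (F' := fun z a => Complex.exp (-(z * Y a)) * (-(Y a)))
      (bound := fun a => (1 + 1 / (z₀.re / 2)) * min 1 (Y a)) ?_
      (integrable_exp_neg_mul_sub_one hY h0 hint hz₀'.le) ?_ ?_ (hint.const_mul _) ?_).2)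
    · refine Eventually.of_forall fun z => AEMeasurable.aestronglyMeasurable ?_
      fun_prop
    · refine AEMeasurable.aestronglyMeasurable ?_
      fun_prop
    · filter_upwards [h0] with a ha z hz
      refine le_trans ?_ (mul_exp_neg_le (half_pos hz₀') ha)
      rw [norm_mul, Complex.norm_exp, norm_neg, Complex.norm_real, Real.norm_of_nonneg ha, mul_comm]
      gcongr
      have := mul_le_mul_of_nonneg_right (hball z hz) ha
      simpa using this
    · refine Eventually.of_forall fun a z _ => ?_
      have := (((hasDerivAt_id z).mul_const (Y a : ℂ)).neg.cexp).sub_const 1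
      simpa using this
  · rw [Complex.closure_setOfPred_lt_re]
    intro z₀ hz₀
    -- The constant is 2 + (1 + ‖z₀‖), valid near `z₀` where ‖z‖ < 1 + ‖z₀‖.
    refine continuousWithinAt_of_dominated (bound := fun a => (3 + ‖z₀‖) * min 1 (Y a)) ?_ ?_
      (hint.const_mul _) ?_
    · refine Eventually.of_forall fun z => AEMeasurable.aestronglyMeasurable ?_
      fun_prop
    · have h1 : ∀ᶠ z in 𝓝[{z : ℂ | 0 ≤ z.re}] z₀, ‖z‖ < 1 + ‖z₀‖ :=
        (continuous_norm.continuousAt.eventually_lt continuousAt_const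
          (by linarith)).filter_mono nhdsWithin_le_nhds
      filter_upwards [h1, self_mem_nhdsWithin] with z hz hz'
      filter_upwards [h0] with a ha
      refine (norm_exp_neg_mul_sub_one_le hz' ha).trans ?_
      have : 0 ≤ min 1 (Y a) := le_min zero_le_one ha
      exact mul_le_mul_of_nonneg_right (by linarith) this
    · refine Eventually.of_forall fun a => Continuous.continuousWithinAt ?_
      fun_prop

lemma norm_exp_integral_exp_neg_mul_sub_one_le_one (hY : AEMeasurable Y μ)
    (h0 : ∀ᵐ a ∂μ, 0 ≤ Y a) (hint : Integrable (fun a => min 1 (Y a)) μ) {z : ℂ} (hz : 0 ≤ z.re)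
    {c : ℝ} (hc : 0 ≤ c) :
    ‖Complex.exp (c * ∫ a, (Complex.exp (-(z * Y a)) - 1) ∂μ)‖ ≤ 1 := by
  rw [Complex.norm_exp, Real.exp_le_one_iff, Complex.re_ofReal_mul]
  refine mul_nonpos_of_nonneg_of_nonpos hc ?_
  have h := integral_re (integrable_exp_neg_mul_sub_one hY h0 hint hz)
  simp only [RCLike.re_eq_complex_re] at h
  rw [← h]
  refine integral_nonpos_of_ae ?_
  filter_upwards [h0] with a ha
  have h1 : 0 ≤ (z * Y a).re := by simpa using mul_nonneg hz ha
  have h2 := (Complex.re_le_norm _).trans (norm_exp_neg_le_one h1)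
  simpa using h2

/-- The characteristic function of a nonnegative infinitely divisible variable without drift
determines its Laplace transform in the right half plane. -/
theorem integral_exp_neg_mul_eq_of_charFun {S : Type*} [MeasurableSpace S] {P : Measure S}
    [IsProbabilityMeasure P] {Z : S → ℝ} (hZ : Measurable Z) (hZ0 : ∀ s, 0 ≤ Z s)
    (hY : AEMeasurable Y μ) (h0 : ∀ᵐ a ∂μ, 0 ≤ Y a)
    (hint : Integrable (fun a => min 1 (Y a)) μ) {c : ℝ} (hc : 0 ≤ c)
    (hchar : ∀ u : ℝ, ∫ s, Complex.exp (Complex.I * u * Z s) ∂P =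
      Complex.exp (c * ∫ a, (Complex.exp (Complex.I * u * Y a) - 1) ∂μ))
    {z : ℂ} (hz : 0 ≤ z.re) :
    ∫ s, Complex.exp (-(z * Z s)) ∂P =
      Complex.exp (c * ∫ a, (Complex.exp (-(z * Y a)) - 1) ∂μ) := by
  have hZint : Integrable (fun s => min 1 (Z s)) P := by
    refine Integrable.of_bound (by fun_prop) 1 (Eventually.of_forall fun s => ?_)
    rw [Real.norm_of_nonneg (le_min zero_le_one (hZ0 s))]
    exact min_le_left _ _
  -- Subtracting 1 puts the transform of `Z` in the form of a Laplace exponent, so one regularity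
  -- lemma serves both sides.
  have hexp (z : ℂ) (hz : 0 ≤ z.re) : ∫ s, Complex.exp (-(z * Z s)) ∂P =
      1 + ∫ s, (Complex.exp (-(z * Z s)) - 1) ∂P := by
    have h := integrable_exp_neg_mul_sub_one hZ.aemeasurable (Eventually.of_forall hZ0) hZint hz
    have := integral_add (integrable_const (1 : ℂ)) h
    simpa using this
  set f : ℂ → ℂ := fun z => (1 + ∫ s, (Complex.exp (-(z * Z s)) - 1) ∂P) -
    Complex.exp (c * ∫ a, (Complex.exp (-(z * Y a)) - 1) ∂μ) with hf
  have hd : DiffContOnCl ℂ f {z | 0 < z.re} := by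
    refine ((diffContOnCl_integral_exp_neg_mul_sub_one hZ.aemeasurable
      (Eventually.of_forall hZ0) hZint).const_add 1).sub ?_
    exact Complex.differentiable_exp.comp_diffContOnCl
      ((diffContOnCl_integral_exp_neg_mul_sub_one hY h0 hint).const_smul (c : ℂ))
  have hbound (z : ℂ) (hz : 0 ≤ z.re) : ‖f z‖ ≤ 2 := by
    refine (norm_sub_le _ _).trans ?_
    have h1 : ‖∫ s, Complex.exp (-(z * Z s)) ∂P‖ ≤ 1 := by
      have := norm_integral_le_of_norm_le_const (μ := P) (C := 1)
        (Eventually.of_forall fun s => norm_exp_neg_le_one (w := z * Z s)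
          (by simpa using mul_nonneg hz (hZ0 s)))
      simpa using this
    rw [hexp z hz] at h1
    linarith [norm_exp_integral_exp_neg_mul_sub_one_le_one hY h0 hint hz hc]
  have hzero : ‖f z‖ ≤ 0 := by
    -- `f` is bounded by 2 on the half plane and vanishes on the imaginary axis, where `hchar`
    -- applies with u = -x; hence the bound 0 inside.
    refine PhragmenLindelof.right_half_plane_of_bounded_on_real hd ⟨0, by norm_num, 0, ?_⟩ ?_ ?_ hz
    · refine Asymptotics.IsBigO.of_bound 2 ?_
      filter_upwards [mem_inf_of_right (mem_principal_self _)] with w hw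
      simpa using hbound w (le_of_lt hw)
    · refine isBoundedUnder_of_eventually_le (a := 2) ?_
      filter_upwards [eventually_ge_atTop 0] with x hx
      exact hbound x (by simpa using hx)
    · intro x
      rw [norm_le_zero_iff]
      have h := hchar (-x)
      have e (y : ℝ) : Complex.I * ((-x : ℝ) : ℂ) * y = -(x * Complex.I * y) := by
        push_cast; ring
      simp only [e] at h
      rw [hexp _ (by simp)] at h
      simp only [hf, h, sub_self]
  rw [norm_le_zero_iff, hf, sub_eq_zero] at hzero
  rw [hexp z hz, hzero]

end Laplace

/-! ### Series expansion of the exponent and the mixture Lévy measure. -/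

section LevyMeasure

open Filter Topology

lemma hasSum_pow_mul_exp_neg (x : ℝ) :
    HasSum (fun m : ℕ => x ^ (m + 1) * Real.exp (-x) / (m + 1).factorial) (1 - Real.exp (-x)) := by
  have h := (NormedSpace.expSeries_div_hasSum_exp x).mul_right (Real.exp (-x))
  rw [← Real.exp_eq_exp_ℝ, ← Real.exp_add, add_neg_cancel, Real.exp_zero] at h
  have h' := (hasSum_nat_add_iff' 1).2 h
  simp only [Finset.sum_range_one, pow_zero, Nat.factorial_zero, Nat.cast_one, div_one,
    one_mul] at h'
  refine h'.congr_fun fun m => ?_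
  ring

/-- With w = exp(iu), this is the difference of the exponential series at wx and x, times e⁻ˣ; the
zeroth terms cancel. -/
lemma hasSum_exp_sub_one_mul (u x : ℝ) :
    HasSum (fun m : ℕ => (Complex.exp (Complex.I * u * (m + 1 : ℕ)) - 1) *
        ((x ^ (m + 1) * Real.exp (-x) / (m + 1).factorial : ℝ) : ℂ))
      (Complex.exp (-((1 - Complex.exp (Complex.I * u)) * x)) - 1) := by
  set w := Complex.exp (Complex.I * u) with hw
  have h1 := (NormedSpace.expSeries_div_hasSum_exp (w * (x : ℂ))).sub
    (NormedSpace.expSeries_div_hasSum_exp (x : ℂ))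
  have h := h1.mul_right (Complex.exp (-x))
  rw [← Complex.exp_eq_exp_ℂ, sub_mul, ← Complex.exp_add, ← Complex.exp_add, add_neg_cancel,
    Complex.exp_zero] at h
  have h' := (hasSum_nat_add_iff' 1).2 h
  simp only [Finset.sum_range_one, pow_zero, sub_self, zero_mul, sub_zero] at h'
  have e : w * x + -(x : ℂ) = -((1 - w) * x) := by ring
  rw [e] at h'
  refine h'.congr_fun fun m => ?_
  have e' : Complex.exp (Complex.I * u * (m + 1 : ℕ)) = w ^ (m + 1) := by
    rw [hw, ← Complex.exp_nat_mul, mul_comm]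
  rw [e']
  push_cast
  rw [mul_pow]
  ring

variable {ρ : Measure ℝ}

lemma ae_pos_of_measure_Iic_eq_zero (hρ : ρ (Iic 0) = 0) : ∀ᵐ x ∂ρ, 0 < x := by
  rw [ae_iff]
  simpa [Iic] using hρ

lemma integrable_min_one (hρ : ρ (Iic 0) = 0)
    (hint : ∫⁻ x, ENNReal.ofReal (min 1 x) ∂ρ < ∞) : Integrable (fun x => min 1 x) ρ := by
  refine ⟨by fun_prop, ?_⟩
  rw [hasFiniteIntegral_iff_ofReal]
  · exact hint
  · filter_upwards [ae_pos_of_measure_Iic_eq_zero hρ] with x hx using le_min zero_le_one hx.le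

/-- Markov's inequality for `min 1 x` gives the exhaustion; σ-finiteness makes integrals over
`ρ.prod G₀` factor. -/
lemma sigmaFinite_of_lintegral_min_one (hρ : ρ (Iic 0) = 0)
    (hint : ∫⁻ x, ENNReal.ofReal (min 1 x) ∂ρ < ∞) : SigmaFinite ρ := by
  refine ⟨⟨⟨fun n => Iic 0 ∪ {x | (1 : ℝ) / (n + 1) ≤ min 1 x}, fun _ => trivial, fun n => ?_, ?_⟩⟩⟩
  · refine (measure_union_le _ _).trans_lt ?_
    rw [hρ, zero_add]
    exact (integrable_min_one hρ hint).measure_ge_lt_top (by positivity)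
  · refine eq_univ_of_forall fun x => mem_iUnion.2 ?_
    rcases le_or_gt x 0 with h | h
    · exact ⟨0, Or.inl h⟩
    · obtain ⟨n, hn⟩ := exists_nat_one_div_lt (lt_min one_pos h)
      exact ⟨n, Or.inr hn.le⟩

/-- By Tonelli the sum is ∫ (1 - e⁻ˣ) dρ. This one bound yields finite coefficients, absolute
convergence, and a finite mixture measure even when `ρ` is infinite. -/
lemma tsum_lintegral_pow_mul_exp_neg_lt_top
    (hint : ∫⁻ x, ENNReal.ofReal (min 1 x) ∂ρ < ∞) :
    ∑' m : ℕ, ∫⁻ x in Ioi 0,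
      ENNReal.ofReal (x ^ (m + 1) * Real.exp (-x) / (m + 1).factorial) ∂ρ < ∞ := by
  rw [← lintegral_tsum fun m => by fun_prop]
  refine lt_of_le_of_lt ?_ hint
  refine le_trans ?_ (lintegral_mono' (Measure.restrict_le_self (s := Ioi 0)) le_rfl)
  refine setLIntegral_mono (by fun_prop) fun x hx => ?_
  have hx' : 0 < x := hx
  rw [← ENNReal.ofReal_tsum_of_nonneg (fun m => by positivity) (hasSum_pow_mul_exp_neg x).summable,
    (hasSum_pow_mul_exp_neg x).tsum_eq]
  refine ENNReal.ofReal_le_ofReal (le_min ?_ ?_)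
  · linarith [Real.exp_pos (-x)]
  · linarith [Real.add_one_le_exp (-x)]

lemma lintegral_pow_mul_exp_neg_lt_top
    (hint : ∫⁻ x, ENNReal.ofReal (min 1 x) ∂ρ < ∞) (m : ℕ) :
    ∫⁻ x in Ioi 0, ENNReal.ofReal (x ^ (m + 1) * Real.exp (-x) / (m + 1).factorial) ∂ρ < ∞ :=
  (ENNReal.ne_top_of_tsum_ne_top (tsum_lintegral_pow_mul_exp_neg_lt_top hint).ne m).lt_top

lemma ae_nonneg_pow_mul_exp_neg (m : ℕ) :
    ∀ᵐ x ∂ρ.restrict (Ioi 0), 0 ≤ x ^ (m + 1) * Real.exp (-x) / (m + 1).factorial := by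
  filter_upwards [ae_restrict_mem measurableSet_Ioi] with x hx
  have hx' : 0 < x := hx
  positivity

lemma integrableOn_pow_mul_exp_neg (hint : ∫⁻ x, ENNReal.ofReal (min 1 x) ∂ρ < ∞) (m : ℕ) :
    IntegrableOn (fun x : ℝ => x ^ (m + 1) * Real.exp (-x) / (m + 1).factorial) (Ioi 0) ρ := by
  refine ⟨by fun_prop, ?_⟩
  rw [hasFiniteIntegral_iff_ofReal (ae_nonneg_pow_mul_exp_neg m)]
  exact lintegral_pow_mul_exp_neg_lt_top hint m

lemma integral_pow_mul_exp_neg_eq (m : ℕ) :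
    ∫ x in Ioi 0, x ^ (m + 1) * Real.exp (-x) / (m + 1).factorial ∂ρ =
      (∫⁻ x in Ioi 0,
        ENNReal.ofReal (x ^ (m + 1) * Real.exp (-x) / (m + 1).factorial) ∂ρ).toReal :=
  integral_eq_lintegral_of_nonneg_ae (ae_nonneg_pow_mul_exp_neg m) (by fun_prop)

lemma summable_integral_pow_mul_exp_neg (hint : ∫⁻ x, ENNReal.ofReal (min 1 x) ∂ρ < ∞) :
    Summable fun m : ℕ =>
      ∫ x in Ioi 0, x ^ (m + 1) * Real.exp (-x) / (m + 1).factorial ∂ρ := by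
  simp only [integral_pow_mul_exp_neg_eq]
  exact ENNReal.summable_toReal (tsum_lintegral_pow_mul_exp_neg_lt_top hint).ne

lemma norm_exp_I_mul_sub_one_le (u x : ℝ) : ‖Complex.exp (Complex.I * u * x) - 1‖ ≤ 2 := by
  have h : ‖Complex.exp (Complex.I * u * x)‖ = 1 := by
    rw [mul_assoc, ← Complex.ofReal_mul, Complex.norm_exp_I_mul_ofReal]
  refine (norm_sub_le _ _).trans ?_
  rw [h, norm_one]
  norm_num

/-- The Laplace exponent at `1 - exp(iu)` as a series. -/
lemma hasSum_exp_sub_one_mul_integral (hρ : ρ (Iic 0) = 0)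
    (hint : ∫⁻ x, ENNReal.ofReal (min 1 x) ∂ρ < ∞) (u : ℝ) :
    HasSum (fun m : ℕ => (Complex.exp (Complex.I * u * (m + 1 : ℕ)) - 1) *
        ((∫ x in Ioi 0, x ^ (m + 1) * Real.exp (-x) / (m + 1).factorial ∂ρ : ℝ) : ℂ))
      (∫ x, (Complex.exp (-((1 - Complex.exp (Complex.I * u)) * (x : ℝ))) - 1) ∂ρ) := by
  have hres : ρ.restrict (Ioi 0) = ρ :=
    Measure.restrict_eq_self_of_ae_mem (ae_pos_of_measure_Iic_eq_zero hρ)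
  have h := hasSum_integral_of_summable_integral_norm (μ := ρ.restrict (Ioi 0))
    (F := fun (m : ℕ) (x : ℝ) => (Complex.exp (Complex.I * u * (m + 1 : ℕ)) - 1) *
        ((x ^ (m + 1) * Real.exp (-x) / (m + 1).factorial : ℝ) : ℂ))
    (fun m => (integrableOn_pow_mul_exp_neg hint m).ofReal.const_mul _) ?_
  · simp only [(hasSum_exp_sub_one_mul u _).tsum_eq, integral_const_mul, integral_complex_ofReal]
      at h
    rw [hres] at h ⊢
    exact h
  -- The factor 2 bounds |exp(iun) - 1|.
  · refine Summable.of_nonneg_of_le (fun m => integral_nonneg fun x => norm_nonneg _) (fun m => ?_)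
      ((summable_integral_pow_mul_exp_neg hint).mul_left 2)
    rw [← integral_const_mul]
    refine integral_mono_of_nonneg (Eventually.of_forall fun x => norm_nonneg _)
      ((integrableOn_pow_mul_exp_neg hint m).const_mul _) ?_
    filter_upwards [ae_nonneg_pow_mul_exp_neg m] with x hx
    rw [norm_mul, Complex.norm_real, Real.norm_of_nonneg hx]
    gcongr
    exact_mod_cast norm_exp_I_mul_sub_one_le u (m + 1 : ℕ)

variable {Ω : Type*} [MeasurableSpace Ω] {G₀ : Measure Ω} [IsFiniteMeasure G₀]

lemma isFiniteMeasure_mixtureLevyMeasure (hint : ∫⁻ x, ENNReal.ofReal (min 1 x) ∂ρ < ∞) :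
    IsFiniteMeasure (mixtureLevyMeasure ρ G₀) := by
  constructor
  rw [mixtureLevyMeasure, Measure.sum_apply _ MeasurableSet.univ]
  simp only [Measure.smul_apply, smul_eq_mul, ← univ_prod_univ, Measure.prod_prod, measure_univ,
    one_mul, ENNReal.tsum_mul_right]
  exact ENNReal.mul_lt_top (tsum_lintegral_pow_mul_exp_neg_lt_top hint) (measure_lt_top _ _)

lemma isLevyMeasure_mixtureLevyMeasure (hint : ∫⁻ x, ENNReal.ofReal (min 1 x) ∂ρ < ∞) :
    IsLevyMeasure (mixtureLevyMeasure ρ G₀) := by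
  refine ⟨?_, ?_⟩
  · rw [mixtureLevyMeasure, Measure.sum_apply_eq_zero]
    intro m
    have : ((m + 1 : ℕ) : ℝ) ∉ Iic (0 : ℝ) := by
      simp only [mem_Iic, not_le]
      positivity
    rw [Measure.smul_apply, Measure.prod_prod, Measure.dirac_apply' _ measurableSet_Iic,
      indicator_of_notMem this]
    simp
  · have := isFiniteMeasure_mixtureLevyMeasure (G₀ := G₀) hint
    refine lt_of_le_of_lt (lintegral_mono fun p => ?_)
      ((lintegral_one (μ := mixtureLevyMeasure ρ G₀)).trans_lt (measure_lt_top _ _))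
    simp

lemma setIntegral_univ_prod_fst {ν : Measure ℝ} [SFinite ν] (A : Set Ω) (f : ℝ → ℂ) :
    ∫ p in univ ×ˢ A, f p.1 ∂(ν.prod G₀) = (G₀ A).toReal * ∫ x, f x ∂ν := by
  rw [← Measure.prod_restrict, Measure.restrict_univ, integral_fun_fst]
  simp [measureReal_def]

lemma setIntegral_mixtureLevyMeasure (hint : ∫⁻ x, ENNReal.ofReal (min 1 x) ∂ρ < ∞)
    (A : Set Ω) (u : ℝ) :
    ∫ p in univ ×ˢ A, (Complex.exp (Complex.I * u * p.1) - 1) ∂(mixtureLevyMeasure ρ G₀) =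
      (G₀ A).toReal * ∑' m : ℕ, (Complex.exp (Complex.I * u * (m + 1 : ℕ)) - 1) *
        ((∫ x in Ioi 0, x ^ (m + 1) * Real.exp (-x) / (m + 1).factorial ∂ρ : ℝ) : ℂ) := by
  have hfin := isFiniteMeasure_mixtureLevyMeasure (G₀ := G₀) hint
  have hi : IntegrableOn (fun p : ℝ × Ω => Complex.exp (Complex.I * u * p.1) - 1) (univ ×ˢ A)
      (mixtureLevyMeasure ρ G₀) :=
    Integrable.of_bound (AEMeasurable.aestronglyMeasurable (by fun_prop)) 2
      (Eventually.of_forall fun p => norm_exp_I_mul_sub_one_le u p.1)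
  rw [IntegrableOn, mixtureLevyMeasure, Measure.restrict_sum_of_countable] at hi
  rw [mixtureLevyMeasure, Measure.restrict_sum_of_countable, integral_sum_measure hi,
    ← tsum_mul_left]
  refine tsum_congr fun m => ?_
  rw [Measure.restrict_smul, integral_smul_measure,
    setIntegral_univ_prod_fst A fun x => Complex.exp (Complex.I * u * x) - 1, integral_dirac,
    integral_pow_mul_exp_neg_eq, Complex.real_smul, Complex.ofReal_natCast]
  ring

end LevyMeasure

/-! ### Application to the count-mixture model. -/

section Model

open Filter Topology

lemma atomicMeasure_apply {S Ω : Type*} [MeasurableSpace Ω] (K : S → ℕ∞) (w : ℕ → S → ℝ≥0)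
    (ω : ℕ → S → Ω) (s : S) {A : Set Ω} (hA : MeasurableSet A) :
    atomicMeasure K w ω s A = ∑' k : ℕ, (((ω k ⁻¹' A).indicator
      (fun s => if (k : ℕ∞) < K s then w k s else 0) s : ℝ≥0) : ℝ≥0∞) := by
  rw [atomicMeasure, Measure.sum_apply _ hA]
  refine tsum_congr fun k => ?_
  rw [Measure.smul_apply, Measure.dirac_apply' _ hA]
  by_cases h : ω k s ∈ A <;> by_cases h' : (k : ℕ∞) < K s <;> simp [indicator, h, h']

lemma atomicMeasure_natCast_apply {S Ω : Type*} [MeasurableSpace Ω] (K : S → ℕ∞)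
    (n : ℕ → S → ℕ) (ω : ℕ → S → Ω) (s : S) {A : Set Ω} (hA : MeasurableSet A) :
    atomicMeasure K (fun k s => (n k s : ℝ≥0)) ω s A = ∑' k : ℕ, (((ω k ⁻¹' A).indicator
      (fun s => if (k : ℕ∞) < K s then n k s else 0) s : ℕ) : ℝ≥0∞) := by
  rw [atomicMeasure_apply _ _ _ _ hA]
  refine tsum_congr fun k => ?_
  by_cases h : ω k s ∈ A <;> by_cases h' : (k : ℕ∞) < K s <;> simp [indicator, h, h']

lemma measurable_ite_lt {S β : Type*} {mS : MeasurableSpace S} [MeasurableSpace β] [Zero β]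
    {K : S → ℕ∞} (hK : Measurable K) {v : S → β} (hv : Measurable v) (k : ℕ) :
    Measurable fun s => if (k : ℕ∞) < K s then v s else 0 :=
  Measurable.ite (hK (MeasurableSet.of_discrete (s := Ioi (k : ℕ∞)))) hv measurable_const

lemma measurable_atomicMeasure {S Ω : Type*} {mS : MeasurableSpace S} [MeasurableSpace Ω]
    {K : S → ℕ∞} (hK : Measurable K) {w : ℕ → S → ℝ≥0} (hw : ∀ k, Measurable (w k))
    {ω : ℕ → S → Ω} (hω : ∀ k, Measurable (ω k)) : Measurable (atomicMeasure K w ω) := by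
  refine Measure.measurable_of_measurable_coe _ fun A hA => ?_
  simp only [atomicMeasure_apply K w ω _ hA]
  refine Measurable.tsum fun k => ?_
  exact ((measurable_ite_lt hK (hw k) k).indicator (hω k hA)).coe_nnreal_ennreal

lemma measurable_poissonMeasure : Measurable poissonMeasure := by
  refine Measure.measurable_of_measurable_coe _ fun B hB => ?_
  simp only [← Measure.tsum_indicator_apply_singleton _ B hB]
  refine Measurable.tsum fun j => ?_
  by_cases hj : j ∈ B
  · simp only [indicator_of_mem hj, poissonMeasure_singleton]
    fun_prop
  · simp only [indicator_of_notMem hj]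
    fun_prop

lemma integral_exp_poissonMeasure (c : ℝ≥0) (u : ℝ) :
    ∫ j, Complex.exp (Complex.I * u * (j : ℕ)) ∂(poissonMeasure c) =
      Complex.exp (-((1 - Complex.exp (Complex.I * u)) * (c : ℝ))) := by
  have h := charFun_map_cast_poissonMeasure c u
  rw [charFun_apply_real, integral_map (by fun_prop) (by fun_prop)] at h
  convert h using 2
  · ext j
    congr 1
    push_cast
    ring
  · rw [mul_comm Complex.I]
    ring

variable {S Ω : Type*} [MeasurableSpace Ω] {ρ : Measure ℝ} {G₀ : Measure Ω}
  {K : S → ℕ∞} {r : ℕ → S → ℝ≥0} {ω : ℕ → S → Ω} {n : ℕ → S → ℕ}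

lemma measurable_atomSigma_K : Measurable[atomSigma K r ω] K :=
  measurable_fst.comp
    (comap_measurable fun s => (K s, (fun k => r k s), (fun k => ω k s)))

lemma measurable_atomSigma_r (k : ℕ) : Measurable[atomSigma K r ω] (r k) :=
  ((measurable_pi_apply k).comp (measurable_fst.comp measurable_snd)).comp
    (comap_measurable fun s => (K s, (fun k => r k s), (fun k => ω k s)))

lemma measurable_atomSigma_ω (k : ℕ) : Measurable[atomSigma K r ω] (ω k) :=
  ((measurable_pi_apply k).comp (measurable_snd.comp measurable_snd)).comp
    (comap_measurable fun s => (K s, (fun k => r k s), (fun k => ω k s)))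

lemma comap_atomicMeasure_le_atomSigma :
    MeasurableSpace.comap (atomicMeasure K r ω) inferInstance ≤ atomSigma K r ω :=
  (measurable_atomicMeasure measurable_atomSigma_K measurable_atomSigma_r
    measurable_atomSigma_ω).comap_le

variable [MeasurableSpace S] {P : Measure S}

lemma IsCountMixture.atomSigma_le (h : IsCountMixture P ρ G₀ K r ω n) :
    atomSigma K r ω ≤ ‹MeasurableSpace S› :=
  (h.measurable_K.prodMk ((measurable_pi_lambda _ h.measurable_r).prodMk
    (measurable_pi_lambda _ h.measurable_ω))).comap_le

lemma IsCountMixture.measurable_counts (h : IsCountMixture P ρ G₀ K r ω n) :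
    Measurable (atomicMeasure K (fun k s => (n k s : ℝ≥0)) ω) :=
  measurable_atomicMeasure h.measurable_K
    (fun k => (measurable_of_countable (Nat.cast : ℕ → ℝ≥0)).comp (h.measurable_n k))
    h.measurable_ω

lemma IsCountMixture.measurable_directing_toNNReal (h : IsCountMixture P ρ G₀ K r ω n)
    {A : Set Ω} (hA : MeasurableSet A) :
    Measurable fun s => (atomicMeasure K r ω s A).toNNReal :=
  ((Measure.measurable_coe hA).comp h.crm.measurable).ennreal_toNNReal

/-- The number of points in `A`, as a natural number. -/
noncomputable def natCount {S Ω : Type*} [MeasurableSpace Ω] (K : S → ℕ∞)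
    (n : ℕ → S → ℕ) (ω : ℕ → S → Ω) (A : Set Ω) (s : S) : ℕ :=
  ⌊(atomicMeasure K (fun k s => (n k s : ℝ≥0)) ω s A).toReal⌋₊

lemma IsCountMixture.measurable_natCount (h : IsCountMixture P ρ G₀ K r ω n)
    {A : Set Ω} (hA : MeasurableSet A) : Measurable (natCount K n ω A) :=
  Nat.measurable_floor.comp ((Measure.measurable_coe hA).comp h.measurable_counts).ennreal_toReal

variable [IsProbabilityMeasure P]

/-- The joint law of the atoms and of the counts in disjoint sets. -/
theorem IsCountMixture.measure_inter_eq (h : IsCountMixture P ρ G₀ K r ω n) {κ : Type*} [Fintype κ]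
    {A : κ → Set Ω} (hA : ∀ i, MeasurableSet (A i))
    (hdisj : Pairwise fun i j => Disjoint (A i) (A j)) (j : κ → ℕ) {B : Set S}
    (hB : MeasurableSet[atomSigma K r ω] B) :
    P (B ∩ {s | ∀ i, atomicMeasure K (fun k s => (n k s : ℝ≥0)) ω s (A i) = j i}) =
      ∫⁻ s in B, ∏ i, poissonMeasure (atomicMeasure K r ω s (A i)).toNNReal {j i} ∂P := by
  simp only [atomicMeasure_natCast_apply K n ω _ (hA _), atomicMeasure_apply K r ω _ (hA _)]
  refine measure_inter_block_tsum_eq (D := fun k i => ω k ⁻¹' A i)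
    (y := fun k s => if (k : ℕ∞) < K s then n k s else 0)
    (c := fun k s => if (k : ℕ∞) < K s then r k s else 0) h.atomSigma_le
    (fun k => measurable_ite_lt measurable_atomSigma_K (measurable_atomSigma_r k) k)
    (fun k => measurable_ite_lt h.measurable_K (h.measurable_n k) k)
    (fun k i => measurable_atomSigma_ω k (hA i)) (fun k i i' hi => (hdisj hi).preimage _)
    (fun N j B hB => ?_) ?_ j hB
  · rw [measure_inter_eq_of_condExp h.atomSigma_le ?_
      (fun s => Finset.prod_nonneg fun i _ => measureReal_nonneg) (h.cond_counts N j) hB]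
    · refine lintegral_congr fun s => ?_
      rw [ENNReal.ofReal_prod_of_nonneg fun i _ => measureReal_nonneg]
      exact Finset.prod_congr rfl fun i _ => ofReal_measureReal
    · rw [ofPred_forall]
      exact MeasurableSet.iInter fun i => measurable_ite_lt h.measurable_K (h.measurable_n i) i
        (measurableSet_singleton (j i))
  · filter_upwards [h.crm.ae_finite] with s hs i
    rw [← atomicMeasure_apply K r ω s (hA i)]
    exact ((measure_mono (subset_univ _)).trans_lt hs).ne

theorem IsCountMixture.isMixedPoissonProcess (h : IsCountMixture P ρ G₀ K r ω n) :
    IsMixedPoissonProcess P (atomicMeasure K r ω)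
      (atomicMeasure K (fun k s => (n k s : ℝ≥0)) ω) := by
  refine ⟨h.crm.measurable, h.measurable_counts, h.crm.ae_finite, fun N A hA hdisj j => ?_⟩
  refine condExp_eq_of_measure_inter
    (comap_atomicMeasure_le_atomSigma.trans h.atomSigma_le) ?_
    (fun s => Finset.prod_nonneg fun i _ => measureReal_nonneg)
    (fun s => Finset.prod_le_one (fun i _ => measureReal_nonneg) fun i _ => measureReal_le_one)
    ?_ fun B hB => ?_
  · rw [ofPred_forall]
    refine MeasurableSet.iInter fun i => ?_
    exact ((Measure.measurable_coe (hA i)).comp h.measurable_counts)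
      (measurableSet_singleton (j i : ℝ≥0∞))
  · have : Measurable fun μ : Measure Ω => ∏ i, (poissonMeasure (μ (A i)).toNNReal).real {j i} := by
      refine Finset.measurable_prod _ fun i _ => ?_
      exact (continuous_poissonMeasure_real_singleton (j i)).measurable.comp
        (Measure.measurable_coe (hA i)).ennreal_toNNReal
    exact this.comp (comap_measurable _)
  -- Events of σ(G) are events of the atom σ-algebra, so the finer identity restricts to them.
  · rw [h.measure_inter_eq hA hdisj j (comap_atomicMeasure_le_atomSigma _ hB)]
    refine lintegral_congr fun s => ?_
    rw [ENNReal.ofReal_prod_of_nonneg fun i _ => measureReal_nonneg]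
    exact Finset.prod_congr rfl fun i _ => by rw [ofReal_measureReal]

/-- The joint law of the counts in disjoint sets. -/
lemma IsCountMixture.measure_forall_eq (h : IsCountMixture P ρ G₀ K r ω n) {κ : Type*} [Fintype κ]
    {A : κ → Set Ω} (hA : ∀ i, MeasurableSet (A i))
    (hdisj : Pairwise fun i j => Disjoint (A i) (A j)) (j : κ → ℕ) :
    P {s | ∀ i, atomicMeasure K (fun k s => (n k s : ℝ≥0)) ω s (A i) = j i} =
      ∫⁻ s, ∏ i, poissonMeasure (atomicMeasure K r ω s (A i)).toNNReal {j i} ∂P := by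
  have := h.measure_inter_eq hA hdisj j MeasurableSet.univ
  rwa [univ_inter, Measure.restrict_univ] at this

lemma IsCountMixture.measure_eq (h : IsCountMixture P ρ G₀ K r ω n)
    {A : Set Ω} (hA : MeasurableSet A) (j : ℕ) :
    P {s | atomicMeasure K (fun k s => (n k s : ℝ≥0)) ω s A = j} =
      ∫⁻ s, poissonMeasure (atomicMeasure K r ω s A).toNNReal {j} ∂P := by
  simpa using h.measure_forall_eq (κ := Unit) (A := fun _ => A) (fun _ => hA)
    (fun i i' hi => (hi rfl).elim) fun _ => j

/-- Poisson masses sum to 1 under the integral, so the value ∞ has probability zero. -/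
lemma IsCountMixture.ae_exists_eq (h : IsCountMixture P ρ G₀ K r ω n)
    {A : Set Ω} (hA : MeasurableSet A) :
    ∀ᵐ s ∂P, ∃ j : ℕ, atomicMeasure K (fun k s => (n k s : ℝ≥0)) ω s A = j := by
  have hm (j : ℕ) : MeasurableSet {s | atomicMeasure K (fun k s => (n k s : ℝ≥0)) ω s A = j} :=
    ((Measure.measurable_coe hA).comp h.measurable_counts) (measurableSet_singleton (j : ℝ≥0∞))
  have hU : P (⋃ j : ℕ, {s | atomicMeasure K (fun k s => (n k s : ℝ≥0)) ω s A = j}) = 1 := by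
    rw [measure_iUnion _ hm]
    · simp only [h.measure_eq hA]
      rw [← lintegral_tsum fun j => ?_]
      · have (c : ℝ≥0) : ∑' j, poissonMeasure c {j} = 1 := by
          simpa using Measure.tsum_indicator_apply_singleton (poissonMeasure c) univ .univ
        simp [this]
      · exact ((Measure.measurable_coe (measurableSet_singleton j)).comp
          (measurable_poissonMeasure.comp (h.measurable_directing_toNNReal hA))).aemeasurable
    · intro j j' hjj
      refine disjoint_left.2 fun s hs hs' => hjj ?_
      exact_mod_cast hs.symm.trans hs'
  have hae := (prob_compl_eq_zero_iff (MeasurableSet.iUnion hm)).2 hU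
  filter_upwards [compl_mem_ae_iff.2 hae] with s hs
  simpa using hs

lemma IsCountMixture.natCount_ae_eq (h : IsCountMixture P ρ G₀ K r ω n)
    {A : Set Ω} (hA : MeasurableSet A) :
    (fun s => (natCount K n ω A s : ℝ≥0∞)) =ᵐ[P]
      fun s => atomicMeasure K (fun k s => (n k s : ℝ≥0)) ω s A := by
  filter_upwards [h.ae_exists_eq hA] with s ⟨j, hj⟩
  rw [natCount, hj]
  simp

lemma IsCountMixture.measure_forall_natCount_eq (h : IsCountMixture P ρ G₀ K r ω n)
    {κ : Type*} [Fintype κ] {A : κ → Set Ω} (hA : ∀ i, MeasurableSet (A i))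
    (hdisj : Pairwise fun i j => Disjoint (A i) (A j)) (j : κ → ℕ) :
    P {s | ∀ i, natCount K n ω (A i) s = j i} =
      ∫⁻ s, ∏ i, poissonMeasure (atomicMeasure K r ω s (A i)).toNNReal {j i} ∂P := by
  rw [← h.measure_forall_eq hA hdisj j]
  refine measure_congr ?_
  have := ae_all_iff.2 fun i => h.natCount_ae_eq (hA i)
  filter_upwards [this] with s hs
  refine propext (forall_congr' fun i => ?_)
  rw [← hs i, Nat.cast_inj]

lemma IsCountMixture.map_natCount_singleton (h : IsCountMixture P ρ G₀ K r ω n)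
    {A : Set Ω} (hA : MeasurableSet A) (j : ℕ) :
    P.map (natCount K n ω A) {j} =
      ∫⁻ s, poissonMeasure (atomicMeasure K r ω s A).toNNReal {j} ∂P := by
  rw [Measure.map_apply (h.measurable_natCount hA) (measurableSet_singleton j)]
  change P {s | natCount K n ω A s = j} = _
  simpa using h.measure_forall_natCount_eq (κ := Unit) (A := fun _ => A) (fun _ => hA)
    (fun i i' hi => (hi rfl).elim) fun _ => j

theorem IsCountMixture.iIndepFun_natCount (h : IsCountMixture P ρ G₀ K r ω n)
    {N : ℕ} {A : Fin N → Set Ω} (hA : ∀ i, MeasurableSet (A i))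
    (hdisj : Pairwise fun i j => Disjoint (A i) (A j)) :
    iIndepFun (fun i => natCount K n ω (A i)) P := by
  rw [iIndepFun_iff_map_fun_eq_pi_map fun i => (h.measurable_natCount (hA i)).aemeasurable]
  have (i : Fin N) : IsProbabilityMeasure (P.map (natCount K n ω (A i))) :=
    Measure.isProbabilityMeasure_map (h.measurable_natCount (hA i)).aemeasurable
  refine Measure.ext_of_singleton fun a => ?_
  rw [Measure.pi_singleton, Measure.map_apply
    (measurable_pi_lambda _ fun i => h.measurable_natCount (hA i)) (measurableSet_singleton a)]
  have he : (fun s i => natCount K n ω (A i) s) ⁻¹' {a} =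
      {s | ∀ i, natCount K n ω (A i) s = a i} := by
    ext s; simp [funext_iff]
  rw [he, h.measure_forall_natCount_eq hA hdisj a]
  simp only [h.map_natCount_singleton (hA _)]
  have hφ (i : Fin N) : Measurable fun x : ℝ≥0∞ => poissonMeasure x.toNNReal {a i} :=
    (Measure.measurable_coe (measurableSet_singleton _)).comp
      (measurable_poissonMeasure.comp measurable_id.ennreal_toNNReal)
  -- Independence of the `G (A i)` lets the expectation factor.
  exact lintegral_prod_eq_prod_lintegral_of_indepFun Finset.univ _
    ((h.crm.indep N A hA hdisj).comp _ hφ)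
    fun i => (hφ i).comp ((Measure.measurable_coe (hA i)).comp h.crm.measurable)

/-- The characteristic function of a count is a Laplace transform of the directing measure. -/
lemma IsCountMixture.integral_exp_eq (h : IsCountMixture P ρ G₀ K r ω n)
    {A : Set Ω} (hA : MeasurableSet A) (u : ℝ) :
    ∫ s, Complex.exp (Complex.I * u *
        (atomicMeasure K (fun k s => (n k s : ℝ≥0)) ω s A).toReal) ∂P =
      ∫ s, Complex.exp (-((1 - Complex.exp (Complex.I * u)) *
        (atomicMeasure K r ω s A).toReal)) ∂P := by
  let κ : Kernel S ℕ := ⟨fun s => poissonMeasure (atomicMeasure K r ω s A).toNNReal,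
    measurable_poissonMeasure.comp (h.measurable_directing_toNNReal hA)⟩
  have hκ : IsMarkovKernel κ :=
    ⟨fun s => inferInstanceAs (IsProbabilityMeasure (poissonMeasure _))⟩
  have hmap : P.map (natCount K n ω A) = κ ∘ₘ P := by
    refine Measure.ext_of_singleton fun j => ?_
    rw [h.map_natCount_singleton hA, Measure.bind_apply (measurableSet_singleton j) κ.aemeasurable]
    rfl
  calc _ = ∫ s, Complex.exp (Complex.I * u * (natCount K n ω A s : ℕ)) ∂P := by
        refine integral_congr_ae ?_
        filter_upwards [h.natCount_ae_eq hA] with s hs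
        rw [← hs]
        simp
    _ = ∫ j, Complex.exp (Complex.I * u * (j : ℕ)) ∂(P.map (natCount K n ω A)) :=
        (integral_map (h.measurable_natCount hA).aemeasurable
          (f := fun j : ℕ => Complex.exp (Complex.I * u * j)) (by fun_prop)).symm
    _ = ∫ s, ∫ j, Complex.exp (Complex.I * u * (j : ℕ)) ∂(κ s) ∂P := by
        have hc : κ ∘ₘ P = (κ ∘ₖ Kernel.const Unit P) () := by
          rw [Kernel.comp_apply, Kernel.const_apply]
        rw [hmap, hc, Kernel.integral_comp, Kernel.const_apply]
        refine Integrable.of_bound (by fun_prop) 1 (Eventually.of_forall fun j => ?_)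
        rw [mul_assoc, ← Complex.ofReal_natCast, ← Complex.ofReal_mul,
          Complex.norm_exp_I_mul_ofReal]
    _ = _ := integral_congr_ae (Eventually.of_forall fun s => integral_exp_poissonMeasure _ u)

theorem IsCountMixture.integral_exp_eq_exp_tsum [IsFiniteMeasure G₀]
    (h : IsCountMixture P ρ G₀ K r ω n) (hρ : ρ (Iic 0) = 0)
    (hint : ∫⁻ x, ENNReal.ofReal (min 1 x) ∂ρ < ∞) {A : Set Ω} (hA : MeasurableSet A) (u : ℝ) :
    ∫ s, Complex.exp (Complex.I * u *
        (atomicMeasure K (fun k s => (n k s : ℝ≥0)) ω s A).toReal) ∂P =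
      Complex.exp ((G₀ A).toReal * ∑' m : ℕ,
        (Complex.exp (Complex.I * u * (m + 1 : ℕ)) - 1) *
          ((∫ x in Ioi 0, x ^ (m + 1) * Real.exp (-x) / (m + 1).factorial ∂ρ : ℝ) : ℂ)) := by
  have := sigmaFinite_of_lintegral_min_one hρ hint
  rw [h.integral_exp_eq hA, (hasSum_exp_sub_one_mul_integral hρ hint u).tsum_eq]
  refine integral_exp_neg_mul_eq_of_charFun
    (Z := fun s => (atomicMeasure K r ω s A).toReal) (Y := id)
    ((Measure.measurable_coe hA).comp h.crm.measurable).ennreal_toReal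
    (fun s => ENNReal.toReal_nonneg) aemeasurable_id
    ((ae_pos_of_measure_Iic_eq_zero hρ).mono fun x hx => hx.le) (integrable_min_one hρ hint)
    ENNReal.toReal_nonneg (fun v => ?_) ?_
  · rw [h.crm.charFun_eq A hA v,
      setIntegral_univ_prod_fst A fun x => Complex.exp (Complex.I * v * x) - 1]
    rfl
  -- The point 1 - exp(iu) lies in the closed right half plane because |exp(iu)| = 1.
  · have h1 : ‖Complex.exp (Complex.I * u)‖ = 1 := Complex.norm_exp_I_mul_ofReal u
    have h2 := Complex.re_le_norm (Complex.exp (Complex.I * u))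
    rw [Complex.sub_re, Complex.one_re]
    linarith

theorem IsCountMixture.isCompletelyRandomMeasure [IsFiniteMeasure G₀]
    (h : IsCountMixture P ρ G₀ K r ω n) (hρ : ρ (Iic 0) = 0)
    (hint : ∫⁻ x, ENNReal.ofReal (min 1 x) ∂ρ < ∞) :
    IsCompletelyRandomMeasure P (atomicMeasure K (fun k s => (n k s : ℝ≥0)) ω)
      (mixtureLevyMeasure ρ G₀) where
  measurable := h.measurable_counts
  ae_finite := by
    filter_upwards [h.ae_exists_eq .univ] with s ⟨j, hj⟩
    rw [hj]
    exact ENNReal.natCast_lt_top j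
  isLevyMeasure := isLevyMeasure_mixtureLevyMeasure hint
  indep N A hA hdisj :=
    ((h.iIndepFun_natCount hA hdisj).comp (fun _ => (Nat.cast : ℕ → ℝ≥0∞))
      fun _ => measurable_of_countable _).congr fun i => h.natCount_ae_eq (hA i)
  charFun_eq A hA u := by
    rw [setIntegral_mixtureLevyMeasure hint, h.integral_exp_eq_exp_tsum hρ hint hA]

end Model

end CountMixture

theorem mainTheorem2 {S Ω : Type*} [MeasurableSpace S] [MeasurableSpace Ω]
    (P : Measure S) [IsProbabilityMeasure P]
    (ρ : Measure ℝ) (hρ_pos : ρ (Iic 0) = 0)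
    (hρ_int : ∫⁻ x, ENNReal.ofReal (min 1 x) ∂ρ < ∞)
    (G₀ : Measure Ω) [IsFiniteMeasure G₀]
    (K : S → ℕ∞) (r : ℕ → S → ℝ≥0) (ω : ℕ → S → Ω) (n : ℕ → S → ℕ)
    (hmodel : CountMixture.IsCountMixture P ρ G₀ K r ω n)
    (X : S → Measure Ω)
    (hX : X = CountMixture.atomicMeasure K (fun k s => (n k s : ℝ≥0)) ω) :
    CountMixture.IsMixedPoissonProcess P (CountMixture.atomicMeasure K r ω) X ∧
    (∀ m : ℕ, IntegrableOn
      (fun x : ℝ => x ^ (m + 1) * Real.exp (-x) / (m + 1).factorial) (Ioi 0) ρ) ∧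
    (∀ u : ℝ, Summable fun m : ℕ =>
      (Complex.exp (Complex.I * u * (m + 1 : ℕ)) - 1) *
        ((∫ x in Ioi 0, x ^ (m + 1) * Real.exp (-x) / (m + 1).factorial ∂ρ : ℝ) : ℂ)) ∧
    (∀ A : Set Ω, MeasurableSet A → ∀ u : ℝ,
      ∫ s, Complex.exp (Complex.I * u * (X s A).toReal) ∂P =
        Complex.exp ((G₀ A).toReal * ∑' m : ℕ,
          (Complex.exp (Complex.I * u * (m + 1 : ℕ)) - 1) *
            ((∫ x in Ioi 0, x ^ (m + 1) * Real.exp (-x) / (m + 1).factorial ∂ρ : ℝ) : ℂ))) ∧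
    CountMixture.IsCompletelyRandomMeasure P X (CountMixture.mixtureLevyMeasure ρ G₀) := by
  subst hX
  exact ⟨hmodel.isMixedPoissonProcess, CountMixture.integrableOn_pow_mul_exp_neg hρ_int,
    fun u => (CountMixture.hasSum_exp_sub_one_mul_integral hρ_pos hρ_int u).summable,
    fun A hA u => hmodel.integral_exp_eq_exp_tsum hρ_pos hρ_int hA u,
    hmodel.isCompletelyRandomMeasure hρ_pos hρ_int⟩
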